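/- All Banach spaces are complex, and $\mathcal B(E)$ denotes the Banach algebra of bounded linear operators on $E$ with the operator norm. Let $X$ and $Y$ be non-zero Banach spaces such that $Y$ is separable and reflexive. Assume that one of the following holds: (1) $X=L_p[0,1]$ (with respect to Lebesgue measure) for some $1<p<\infty$; or (2) $X$ is reflexive and has a subsymmetric Schauder basis, that is, an unconditional Schauder basis $(b_n)_{n\in\mathbb N}$ such that for every strictly increasing $\sigma\colon\mathbb N\to\mathbb N$ the sequence $(b_{\sigma(n)})$ is equivalent to $(b_n)$: for every scalar sequence $(a_n)$, the series $\sum_n a_n b_{\sigma(n)}$ converges if and only if $\sum_n a_n b_n$ converges. Let $\phi\colon\mathcal B(X)\to\mathcal B(Y)$ be a continuous, injective algebra homomorphism (that is, linear and multiplicative, not assumed to be unital). Suppose that there is $T\in\mathcal B(X)$ such that $\phi(T)$ has dense range in $Y$, and that $\phi$ maps rank-one idempotents to rank-one idempotents. Then $\phi$ is an isomorphism of Banach algebras, that is, $\phi$ is also a homeomorphism of $\mathcal B(X)$ onto $\mathcal B(Y)$. In fact there is a linear homeomorphism $S\colon X\to Y$ such that $\phi(A)=SAS^{-1}$ for all $A\in\mathcal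 B(X)$. -/

import Mathlib

open MeasureTheory Filter Topology
open scoped ENNReal

/-- A complex normed space is reflexive if the canonical isometric embedding into its bidual
is onto. -/
def IsReflexiveSpace (E : Type*) [NormedAddCommGroup E] [NormedSpace ℂ E] : Prop :=
  Function.Surjective (NormedSpace.inclusionInDoubleDual ℂ E)

/-- The series `∑ x n` converges in norm, in the usual sense that its sequence of partial sums
has a limit. -/
def SeriesConverges {E : Type*} [NormedAddCommGroup E] (x : ℕ → E) : Prop :=
  ∃ l : E, Tendsto (fun N : ℕ => ∑ n ∈ Finset.range N, x n) atTop (𝓝 l)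

/-- Two (basic) sequences are equivalent if, for all scalar sequences `a`, the series
`∑ a n • x n` converges if and only if `∑ a n • y n` does. -/
def EquivalentSequences {E F : Type*} [NormedAddCommGroup E] [NormedSpace ℂ E]
    [NormedAddCommGroup F] [NormedSpace ℂ F] (x : ℕ → E) (y : ℕ → F) : Prop :=
  ∀ a : ℕ → ℂ, SeriesConverges (fun n => a n • x n) ↔ SeriesConverges (fun n => a n • y n)

/-- An unconditional Schauder basis `b` is subsymmetric if it is equivalent to each of its
subsequences. -/
def IsSubsymmetric {E : Type*} [NormedAddCommGroup E] [NormedSpace ℂ E]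
    (b : UnconditionalSchauderBasis ℕ ℂ E) : Prop :=
  ∀ σ : ℕ → ℕ, StrictMono σ → EquivalentSequences (fun n => b (σ n)) (fun n => b n)

/-- `E` has a subsymmetric Schauder basis. -/
def HasSubsymmetricBasis (E : Type*) [NormedAddCommGroup E] [NormedSpace ℂ E] : Prop :=
  ∃ b : UnconditionalSchauderBasis ℕ ℂ E, IsSubsymmetric b

/-- `E` is, up to a linear isometry, the complex space `L_p[0,1]` of the Lebesgue measure
for some `1 < p < ∞`. -/
def IsLpUnitInterval (E : Type*) [NormedAddCommGroup E] [NormedSpace ℂ E] : Prop :=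
  ∃ (p : ℝ≥0∞) (_ : Fact (1 ≤ p)), 1 < p ∧ p < ∞ ∧
    Nonempty (E ≃ₗᵢ[ℂ] Lp ℂ p ((volume : Measure ℝ).restrict (Set.Icc 0 1)))

/-- A bounded idempotent operator with one-dimensional range. -/
def IsRankOneIdempotent {E : Type*} [NormedAddCommGroup E] [NormedSpace ℂ E]
    (P : E →L[ℂ] E) : Prop :=
  IsIdempotentElem P ∧ Module.finrank ℂ (LinearMap.range (P : E →ₗ[ℂ] E)) = 1

/-!
Fix a rank-one idempotent `x₀ ⊗ f₀` of `X` and its image `y₀ ⊗ g`. The maps `S x = φ (x ⊗ f₀) y₀`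
and `R f = g ∘ φ (x₀ ⊗ f)` satisfy `φ A ∘ S = S ∘ A`, `R f ∘ S = f` and `φ (x ⊗ f) = S x ⊗ R f`
(`exists_intertwiner`). Thus `S` is an embedding, and `X` is reflexive because `Y` is
(`IsReflexiveSpace.of_extension`). Reflexivity turns the adjoint of `R` into an operator
`V : Y → X` with `V S = 1`, so that `Y` is the direct sum of the copy `S X` of `X` and of `ker V`,
and every finite-rank operator of `X` acts as `0` on `ker V`. It remains to show that `ker V = 0`.

The dense range of some `φ T` makes `φ` unital. Suppose that the identity of `X` has continuum many
factorizations `A c ∘ B c = 1` whose mixed products `A c ∘ B d`, `c ≠ d`, have finite rank. For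
`w ≠ 0` in `ker V`, the operator `φ (A c)` then maps `φ (B c) w` to `w` and every other `φ (B d) w`
to `0`, so these vectors form an uncountable discrete set in the separable space `Y`, which is
absurd (`HasAlmostOrthogonalFactorizations.apply_id_eq_zero`).

Such factorizations come from the branches of the binary tree, an almost disjoint family of
continuum many infinite subsets of `ℕ` with increasing enumerations `branch c`.

* For a subsymmetric basis `b`, take `B c : b n ↦ b (branch c n)`, and for `A c` its left inverse
  that annihilates the other basis vectors. Boundedness follows from the Banach–Steinhaus theorem.
* Binary expansion identifies `L^p[0, 1]` with `L^p` of the infinite coin-tossing space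
  `ℕ → Fin 2`. There `B c` composes a function with the restriction of sequences to the positions
  `branch c`, and `A c` averages over the other positions. The range of `A c ∘ B d` consists of
  functions of the finitely many coordinates that two different branches share. No
  unconditionality of the Haar system is needed.
-/

/-! ### The action of the homomorphism on rank-one operators -/

theorem IsRankOneIdempotent.exists_eq_smul {E : Type*} [NormedAddCommGroup E] [NormedSpace ℂ E]
    {P : E →L[ℂ] E} (hP : IsRankOneIdempotent P) :
    ∃ (y₀ : E) (g : StrongDual ℂ E), y₀ ≠ 0 ∧ P y₀ = y₀ ∧ g y₀ = 1 ∧ ∀ y, P y = g y • y₀ := by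
  obtain ⟨hidem, hrk⟩ := hP
  obtain ⟨⟨y₀, x, hx⟩, hne, hgen⟩ := finrank_eq_one_iff'.1 hrk
  have hy₀ : y₀ ≠ 0 := fun h => hne (by ext; exact h)
  have hPy₀ : P y₀ = y₀ := by
    have hx' : P x = y₀ := hx
    rw [← hx']
    exact congrArg (fun Q : E →L[ℂ] E => Q x) hidem
  obtain ⟨g, hg⟩ := SeparatingDual.exists_eq_one (R := ℂ) hy₀
  have hform : ∀ y, P y = g (P y) • y₀ := by
    intro y
    obtain ⟨c, hc⟩ := hgen ⟨P y, y, rfl⟩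
    have hc' : c • y₀ = P y := congrArg Subtype.val hc
    rw [← hc', map_smul, hg, smul_eq_mul, mul_one]
  exact ⟨y₀, g ∘L P, hy₀, hPy₀, by simp [hPy₀, hg], hform⟩

theorem isRankOneIdempotent_smulRight {E : Type*} [NormedAddCommGroup E] [NormedSpace ℂ E]
    {x : E} {f : StrongDual ℂ E} (hfx : f x = 1) : IsRankOneIdempotent (f.smulRight x) := by
  have hx : x ≠ 0 := by rintro rfl; simp at hfx
  refine ⟨?_, ?_⟩
  · ext y
    simp [hfx]
  · have : LinearMap.range (f.smulRight x : E →ₗ[ℂ] E) = ℂ ∙ x := by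
      ext y
      rw [Submodule.mem_span_singleton]
      constructor
      · rintro ⟨z, rfl⟩
        exact ⟨f z, rfl⟩
      · rintro ⟨c, rfl⟩
        exact ⟨c • x, by simp [hfx]⟩
    rw [this, finrank_span_singleton hx]

/-- On rank-one operators, a homomorphism preserving rank-one idempotents acts as
`x ⊗ f ↦ S x ⊗ R f`, where `S` intertwines it with the identity representation. If `x₀ ⊗ f₀` is an
idempotent with image `y₀ ⊗ g`, then `S x = φ (x ⊗ f₀) y₀` and `R f = g ∘ φ (x₀ ⊗ f)`. -/
theorem exists_intertwiner {X Y : Type*}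
    [NormedAddCommGroup X] [NormedSpace ℂ X] [Nontrivial X]
    [NormedAddCommGroup Y] [NormedSpace ℂ Y]
    (φ : (X →L[ℂ] X) →ₙₐ[ℂ] (Y →L[ℂ] Y)) (hcont : Continuous φ)
    (hrank : ∀ P : X →L[ℂ] X, IsRankOneIdempotent P → IsRankOneIdempotent (φ P)) :
    ∃ (S : X →L[ℂ] Y) (R : StrongDual ℂ X →L[ℂ] StrongDual ℂ Y),
      (∀ A x, φ A (S x) = S (A x)) ∧ (∀ f x, R f (S x) = f x) ∧
      ∀ (f : StrongDual ℂ X) x y, φ (f.smulRight x) y = R f y • S x := by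
  obtain ⟨x₀, hx₀⟩ := exists_ne (0 : X)
  obtain ⟨f₀, hf₀⟩ := SeparatingDual.exists_eq_one (R := ℂ) hx₀
  obtain ⟨y₀, g, hy₀, hPy₀, hgy₀, hP⟩ :=
    (hrank _ (isRankOneIdempotent_smulRight hf₀)).exists_eq_smul
  let Φ : (X →L[ℂ] X) →L[ℂ] (Y →L[ℂ] Y) :=
    { toFun := φ, map_add' := map_add φ, map_smul' := map_smul φ, cont := hcont }
  have hmul : ∀ A B y, φ (A * B) y = φ A (φ B y) := fun A B y => by
    rw [map_mul]; rfl
  let S : X →L[ℂ] Y :=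
    (ContinuousLinearMap.apply ℂ Y y₀) ∘L Φ ∘L (ContinuousLinearMap.smulRightL ℂ X X f₀)
  have hS : ∀ x, S x = φ (f₀.smulRight x) y₀ := fun x => rfl
  let R : StrongDual ℂ X →L[ℂ] StrongDual ℂ Y :=
    (ContinuousLinearMap.compL ℂ Y Y ℂ g) ∘L Φ ∘L
      ((ContinuousLinearMap.smulRightL ℂ X X).flip x₀)
  have hR : ∀ f y, R f y = g (φ (f.smulRight x₀) y) := fun f y => rfl
  have hform : ∀ (f : StrongDual ℂ X) y, φ (f.smulRight x₀) y = R f y • y₀ := by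
    intro f y
    have : f.smulRight x₀ = f₀.smulRight x₀ * f.smulRight x₀ := by
      ext z; simp [hf₀]
    rw [hR, ← hP, ← hmul, ← this]
  refine ⟨S, R, ?_, ?_, ?_⟩
  · intro A x
    rw [hS, hS, ← hmul]
    congr 2
    ext z; simp
  · intro f x
    have h1 : (f.smulRight x₀ : X →L[ℂ] X) * f₀.smulRight x = f x • f₀.smulRight x₀ := by
      ext z; simp [smul_smul, mul_comm]
    rw [hR, hS, ← hmul, h1, map_smul]
    simp [hPy₀, hgy₀]
  · intro f x y
    have h1 : f.smulRight x = (f₀.smulRight x : X →L[ℂ] X) * f.smulRight x₀ := by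
      ext z; simp [hf₀]
    rw [h1, hmul, hform, map_smul, ← hS]

/-- Reflexivity passes to `X` along an embedding `S : X → Y` for which the functionals on `S X`
extend to `Y` by a bounded linear map `R`. -/
theorem IsReflexiveSpace.of_extension {X Y : Type*}
    [NormedAddCommGroup X] [NormedSpace ℂ X] [CompleteSpace X]
    [NormedAddCommGroup Y] [NormedSpace ℂ Y] (hY : IsReflexiveSpace Y)
    (S : X →L[ℂ] Y) (R : StrongDual ℂ X →L[ℂ] StrongDual ℂ Y)
    (hRS : ∀ f x, R f (S x) = f x) : IsReflexiveSpace X := by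
  have hbelow : ∀ x, ‖x‖ ≤ ‖R‖ * ‖S x‖ := by
    intro x
    refine NormedSpace.norm_le_dual_bound ℂ x (by positivity) fun f => ?_
    rw [← hRS f x]
    calc ‖R f (S x)‖ ≤ ‖R f‖ * ‖S x‖ := (R f).le_opNorm _
      _ ≤ (‖R‖ * ‖f‖) * ‖S x‖ := by gcongr; exact R.le_opNorm f
      _ = _ := by ring
  have hanti : AntilipschitzWith ‖R‖₊ S :=
    ContinuousLinearMap.antilipschitz_of_bound S hbelow
  have hclosed : IsClosed (Set.range S) := hanti.isClosed_range S.uniformContinuous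
  intro ξ
  obtain ⟨y, hy⟩ := hY (ξ ∘L (ContinuousLinearMap.compL ℂ X Y ℂ).flip S)
  have hy' : ∀ h : StrongDual ℂ Y, h y = ξ (h ∘L S) := fun h =>
    congrArg (fun η : StrongDual ℂ (StrongDual ℂ Y) => η h) hy
  have hmem : y ∈ Set.range S := by
    by_contra hn
    have hconv : Convex ℝ (Set.range S) :=
      ((LinearMap.range (S : X →ₗ[ℂ] Y)).restrictScalars ℝ).convex
    obtain ⟨h, u, hu, hu'⟩ :=
      RCLike.geometric_hahn_banach_point_closed (𝕜 := ℂ) hconv hclosed hn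
    have hhS : h ∘L S = 0 := by
      -- otherwise `h ∘ S` takes the value `u`
      ext x
      by_contra hx
      have hx' : h (S x) ≠ 0 := hx
      have := hu' (S (((u : ℂ) / h (S x)) • x)) ⟨_, rfl⟩
      simp [hx'] at this
    have h0 := hu' (S 0) ⟨0, rfl⟩
    rw [hy', hhS] at hu
    simp at h0 hu
    linarith
  obtain ⟨x, rfl⟩ := hmem
  refine ⟨x, ?_⟩
  ext f
  have h1 : R f ∘L S = f := by ext z; exact hRS f z
  rw [NormedSpace.dual_def, ← hRS f x, hy', h1]

/-! ### Almost orthogonal factorizations and separability -/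

/-- A family of factorizations `A c ∘ B c = 1` of the identity of `E`, indexed by the Cantor set,
with mixed products `A c ∘ B d` of finite rank. The idempotents `B c ∘ A c` then have ranges
isomorphic to `E` and are mutually orthogonal modulo finite-rank operators. -/
def HasAlmostOrthogonalFactorizations (E : Type*) [NormedAddCommGroup E] [NormedSpace ℂ E] :
    Prop :=
  ∃ A B : (ℕ → Bool) → (E →L[ℂ] E), (∀ c, A c ∘L B c = .id ℂ E) ∧
    ∀ c d, c ≠ d → FiniteDimensional ℂ (LinearMap.range (A c ∘L B d : E →ₗ[ℂ] E))

theorem finiteRank_eq_sum_smulRight {E : Type*} [NormedAddCommGroup E] [NormedSpace ℂ E]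
    (F : E →L[ℂ] E) [FiniteDimensional ℂ (LinearMap.range (F : E →ₗ[ℂ] E))] :
    ∃ (n : ℕ) (f : Fin n → StrongDual ℂ E) (x : Fin n → E), F = ∑ i, (f i).smulRight (x i) := by
  let b := Module.finBasis ℂ (LinearMap.range (F : E →ₗ[ℂ] E))
  let G : E →L[ℂ] LinearMap.range (F : E →ₗ[ℂ] E) := F.codRestrict _ fun z => ⟨z, rfl⟩
  refine ⟨_, fun i => (LinearMap.toContinuousLinearMap (b.coord i)) ∘L G, fun i => b i, ?_⟩
  ext z
  have h : ((∑ i, b.repr (G z) i • b i : LinearMap.range (F : E →ₗ[ℂ] E)) : E) = F z :=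
    congrArg Subtype.val (b.sum_repr (G z))
  rw [AddSubmonoidClass.coe_finsetSum] at h
  rw [sum_apply]
  exact h.symm

/-- This is where the separability of `Y` enters. If `φ 1 w ≠ 0`, then the vectors `φ (B c) w`
form an uncountable discrete subset of `Y`: finite-rank operators act as `0` at `w`, so that
`φ (A c)` maps `φ (B c) w` to `φ 1 w` and each of the other vectors to `0`. -/
theorem HasAlmostOrthogonalFactorizations.apply_id_eq_zero {X Y : Type*}
    [NormedAddCommGroup X] [NormedSpace ℂ X]
    [NormedAddCommGroup Y] [NormedSpace ℂ Y] [TopologicalSpace.SeparableSpace Y]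
    (hX : HasAlmostOrthogonalFactorizations X)
    (φ : (X →L[ℂ] X) →ₙₐ[ℂ] (Y →L[ℂ] Y)) {w : Y}
    (hw : ∀ (f : StrongDual ℂ X) x, φ (f.smulRight x) w = 0) :
    φ (.id ℂ X) w = 0 := by
  obtain ⟨A, B, hAB, hfin⟩ := hX
  by_contra hne
  have hmul : ∀ F G y, φ (F * G) y = φ F (φ G y) := fun F G y => by
    rw [map_mul]; rfl
  have hdiag : ∀ c, φ (A c) (φ (B c) w) = φ (.id ℂ X) w := fun c => by
    rw [← hmul, ← hAB c]; rfl
  have hoff : ∀ c d, c ≠ d → φ (A c) (φ (B d) w) = 0 := by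
    intro c d hcd
    have := hfin c d hcd
    obtain ⟨n, f, x, hF⟩ := finiteRank_eq_sum_smulRight (A c ∘L B d)
    rw [← hmul]
    change φ (A c ∘L B d) w = 0
    rw [hF, map_sum, sum_apply]
    exact Finset.sum_eq_zero fun i _ => hw _ _
  let v : (ℕ → Bool) → Y := fun c => φ (B c) w
  have hinj : Function.Injective v := by
    intro c d hcd
    by_contra hne'
    have h1 : φ (A c) (v c) = φ (A c) (v d) := by rw [hcd]
    exact hne ((hdiag c).symm.trans (h1.trans (hoff c d hne')))
  have hdisc : DiscreteTopology (Set.range v) := by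
    rw [discreteTopology_iff_isOpen_singleton]
    rintro ⟨_, c, rfl⟩
    -- `φ (A c)` vanishes at every `v d` with `d ≠ c`, but not at `v c`
    refine ⟨{y | φ (A c) y ≠ 0}, isOpen_ne_fun (φ (A c)).continuous continuous_const, ?_⟩
    ext ⟨_, d, rfl⟩
    simp only [Set.mem_preimage, Set.mem_ofPred_eq, Set.mem_singleton_iff]
    refine ⟨fun h => ?_, fun h => ?_⟩
    · by_contra hcd
      exact h (hoff c d fun h => hcd (by rw [h]))
    · rw [show v d = v c from congrArg Subtype.val h]
      exact fun h' => hne ((hdiag c).symm.trans h')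
  have : SecondCountableTopology Y := UniformSpace.secondCountable_of_separable Y
  have hcount : Countable (Set.range v) := countable_of_Lindelof_of_discrete
  have : Countable (ℕ → Bool) :=
    Function.Injective.countable (f := Set.rangeFactorization v) fun c d h =>
      hinj (congrArg Subtype.val h)
  obtain ⟨e, he⟩ := exists_surjective_nat (ℕ → Bool)
  obtain ⟨n, hn⟩ := he fun n => !(e n n)
  have := congrFun hn n
  simp at this

theorem HasAlmostOrthogonalFactorizations.of_equiv {E F : Type*}
    [NormedAddCommGroup E] [NormedSpace ℂ E] [NormedAddCommGroup F] [NormedSpace ℂ F]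
    (hE : HasAlmostOrthogonalFactorizations E) (e : E ≃L[ℂ] F) :
    HasAlmostOrthogonalFactorizations F := by
  obtain ⟨A, B, hAB, hfin⟩ := hE
  refine ⟨fun c => e.arrowCongr e (A c), fun c => e.arrowCongr e (B c), fun c => ?_,
    fun c d hcd => ?_⟩
  · ext y
    have := congrArg (fun T : E →L[ℂ] E => e (T (e.symm y))) (hAB c)
    simpa using this
  · have := hfin c d hcd
    have h2 : FiniteDimensional ℂ
        ((LinearMap.range (A c ∘L B d : E →ₗ[ℂ] E)).map (e : E →ₗ[ℂ] F)) := inferInstance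
    refine Submodule.finiteDimensional_of_le
      (S₂ := (LinearMap.range (A c ∘L B d : E →ₗ[ℂ] E)).map (e : E →ₗ[ℂ] F)) ?_
    rintro _ ⟨y, rfl⟩
    exact ⟨A c (B d (e.symm y)), ⟨e.symm y, rfl⟩, by simp⟩

/-- Dualizing `R` gives a left inverse `V` of the intertwiner `S`. On `ker V`, which complements the
range of `S`, the representation `φ` annihilates the finite-rank operators, so `ker V` is trivial
by the separability of `Y`. -/
theorem HasAlmostOrthogonalFactorizations.exists_eq_conj {X Y : Type*}
    [NormedAddCommGroup X] [NormedSpace ℂ X] [CompleteSpace X] [Nontrivial X]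
    [NormedAddCommGroup Y] [NormedSpace ℂ Y]
    [TopologicalSpace.SeparableSpace Y] (hY : IsReflexiveSpace Y)
    (hX : HasAlmostOrthogonalFactorizations X)
    (φ : (X →L[ℂ] X) →ₙₐ[ℂ] (Y →L[ℂ] Y)) (hcont : Continuous φ)
    (hdense : ∃ T : X →L[ℂ] X, DenseRange (φ T))
    (hrank : ∀ P : X →L[ℂ] X, IsRankOneIdempotent P → IsRankOneIdempotent (φ P)) :
    ∃ S : X ≃L[ℂ] Y, ∀ A : X →L[ℂ] X,
      φ A = (S : X →L[ℂ] Y) ∘L A ∘L (S.symm : Y →L[ℂ] X) := by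
  obtain ⟨S, R, hSA, hRS, hsmul⟩ := exists_intertwiner φ hcont hrank
  have hXr : IsReflexiveSpace X := hY.of_extension S R hRS
  let J : X ≃ₗᵢ[ℂ] StrongDual ℂ (StrongDual ℂ X) :=
    LinearIsometryEquiv.ofSurjective (NormedSpace.inclusionInDoubleDualLi ℂ) hXr
  let V : Y →L[ℂ] X := (J.symm : StrongDual ℂ (StrongDual ℂ X) →L[ℂ] X) ∘L R.flip
  have hV : ∀ (f : StrongDual ℂ X) y, f (V y) = R f y := by
    intro f y
    have h1 : J (V y) = R.flip y := J.apply_symm_apply _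
    exact congrArg (fun η : StrongDual ℂ (StrongDual ℂ X) => η f) h1
  have hVS : ∀ x, V (S x) = x := by
    intro x
    refine (SeparatingDual.eq_iff_forall_dual_eq (R := ℂ)).2 fun f => ?_
    rw [hV, hRS]
  -- `φ 1` is an idempotent whose closed range contains the dense range of `φ T`
  have hone : ∀ y, φ (.id ℂ X) y = y := by
    obtain ⟨T, hT⟩ := hdense
    have := hT.equalizer (φ (.id ℂ X)).continuous continuous_id <| by
      ext y
      change (φ (.id ℂ X) * φ T) y = φ T y
      rw [← map_mul]
      rfl
    exact fun y => congrFun this y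
  have hker : ∀ w, V w = 0 → w = 0 := by
    intro w hw
    rw [← hone w]
    refine hX.apply_id_eq_zero φ fun f x => ?_
    rw [hsmul, ← hV, hw, map_zero, zero_smul]
  have hSV : ∀ y, S (V y) = y := by
    intro y
    have : S (V y) - y = 0 := hker _ (by rw [map_sub, hVS, sub_self])
    exact sub_eq_zero.1 this
  refine ⟨.equivOfInverse S V hVS hSV, fun A => ?_⟩
  ext y
  conv_lhs => rw [← hSV y]
  exact hSA A (V y)

theorem isHomeomorph_of_eq_conj {X Y : Type*}
    [NormedAddCommGroup X] [NormedSpace ℂ X] [NormedAddCommGroup Y] [NormedSpace ℂ Y]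
    {φ : (X →L[ℂ] X) →ₙₐ[ℂ] (Y →L[ℂ] Y)} (S : X ≃L[ℂ] Y)
    (hS : ∀ A : X →L[ℂ] X, φ A = (S : X →L[ℂ] Y) ∘L A ∘L (S.symm : Y →L[ℂ] X)) :
    IsHomeomorph φ := by
  have : (φ : (X →L[ℂ] X) → (Y →L[ℂ] Y)) = S.arrowCongr S := by
    ext A y
    rw [hS]
    simp
  rw [this]
  exact (S.arrowCongr S).toHomeomorph.isHomeomorph

/-! ### An almost disjoint family -/

/-- The natural number with binary digits `1, c 0, …, c (n - 1)`, leading digit first. For varying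
`c`, the ranges of `branch c` form an almost disjoint family of infinite sets: they are the
branches of the binary tree. -/
def branch (c : ℕ → Bool) : ℕ → ℕ
  | 0 => 1
  | n + 1 => 2 * branch c n + (c n).toNat

theorem branch_pos (c : ℕ → Bool) (n : ℕ) : 0 < branch c n := by
  induction n with
  | zero => simp [branch]
  | succ n ih => simp only [branch]; omega

theorem branch_strictMono (c : ℕ → Bool) : StrictMono (branch c) := by
  refine strictMono_nat_of_lt_succ fun n => ?_
  have := branch_pos c n
  simp only [branch]
  omega

theorem branch_eq_branch {c d : ℕ → Bool} {m n : ℕ} (h : branch c m = branch d n) :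
    m = n ∧ ∀ i < n, c i = d i := by
  induction n generalizing m with
  | zero =>
    cases m with
    | zero => simp
    | succ m =>
      have := branch_pos c m
      simp only [branch] at h
      omega
  | succ n ih =>
    cases m with
    | zero =>
      have := branch_pos d n
      simp only [branch] at h
      omega
    | succ m =>
      simp only [branch] at h
      have hc := Bool.toNat_lt (c m)
      have hd := Bool.toNat_lt (d n)
      obtain ⟨rfl, hi⟩ := ih (m := m) (by omega)
      have hcd : c m = d m := by
        have : (c m).toNat = (d m).toNat := by omega
        revert this
        cases c m <;> cases d m <;> simp
      refine ⟨rfl, fun i hi' => ?_⟩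
      rcases Nat.lt_succ_iff_lt_or_eq.1 hi' with h' | rfl
      · exact hi i h'
      · exact hcd

theorem exists_forall_branch_ne {c d : ℕ → Bool} (hcd : c ≠ d) :
    ∃ K, ∀ m n, K ≤ n → branch c m ≠ branch d n := by
  obtain ⟨k, hk⟩ := Function.ne_iff.1 hcd
  exact ⟨k + 1, fun m n hn h => hk ((branch_eq_branch h).2 k hn)⟩

/-! ### Subsymmetric bases -/

/-- A form of the Banach–Steinhaus theorem: a pointwise convergent series of rank-one operators
has a bounded sum. -/
theorem exists_tendsto_sum_smul {E F : Type*} [NormedAddCommGroup E] [NormedSpace ℂ E]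
    [CompleteSpace E] [NormedAddCommGroup F] [NormedSpace ℂ F]
    (f : ℕ → StrongDual ℂ E) (u : ℕ → F) (h : ∀ x, SeriesConverges fun n => f n x • u n) :
    ∃ T : E →L[ℂ] F, ∀ x,
      Tendsto (fun N => ∑ n ∈ Finset.range N, f n x • u n) atTop (𝓝 (T x)) := by
  choose l hl using h
  have hlim : Tendsto (fun N x => (∑ n ∈ Finset.range N, (f n).smulRight (u n) : E →L[ℂ] F) x)
      atTop (𝓝 l) := by
    refine tendsto_pi_nhds.2 fun x => ?_
    simpa [sum_apply] using hl x
  exact ⟨continuousLinearMapOfTendsto _ hlim, hl⟩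

/-- With respect to a subsymmetric basis `b`, the shift `b n ↦ b (σ n)` and its left inverse,
which annihilates the basis vectors outside the range of `σ`, are bounded. Unconditionality gives
the convergence of the subseries that define the left inverse. -/
theorem IsSubsymmetric.exists_shift {E : Type*} [NormedAddCommGroup E] [NormedSpace ℂ E]
    [CompleteSpace E] {b : UnconditionalSchauderBasis ℕ ℂ E} (hb : IsSubsymmetric b)
    {σ : ℕ → ℕ} (hσ : StrictMono σ) :
    ∃ A B : E →L[ℂ] E, (∀ n, A (b (σ n)) = b n) ∧ (∀ m, (∀ n, σ n ≠ m) → A (b m) = 0) ∧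
      ∀ x, Tendsto (fun N => ∑ n ∈ Finset.range N, b.coord n x • b (σ n)) atTop (𝓝 (B x)) := by
  obtain ⟨B, hB⟩ := exists_tendsto_sum_smul b.coord (fun n => b (σ n)) fun x =>
    (hb σ hσ _).2 ⟨x, (b.expansion x).tendsto_sum_nat⟩
  obtain ⟨A, hA⟩ := exists_tendsto_sum_smul (fun n => b.coord (σ n)) (fun n => b n) fun x =>
    (hb σ hσ _).1 ⟨_, ((b.expansion x).summable.comp_injective hσ.injective).hasSum.tendsto_sum_nat⟩
  refine ⟨A, B, fun m => ?_, fun m hm => ?_, hB⟩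
  · refine tendsto_nhds_unique (hA _) (tendsto_const_nhds.congr' ?_)
    filter_upwards [eventually_gt_atTop m] with N hN
    rw [Finset.sum_eq_single_of_mem m (Finset.mem_range.2 hN)]
    · simp [b.ortho]
    · intro n _ hn
      simp [b.ortho, hσ.injective.eq_iff, hn]
  · refine tendsto_nhds_unique (hA _) (tendsto_const_nhds.congr fun N => ?_)
    exact (Finset.sum_eq_zero fun n _ => by simp [b.ortho, hm n]).symm

theorem HasSubsymmetricBasis.hasAlmostOrthogonalFactorizations {E : Type*}
    [NormedAddCommGroup E] [NormedSpace ℂ E] [CompleteSpace E] (hE : HasSubsymmetricBasis E) :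
    HasAlmostOrthogonalFactorizations E := by
  obtain ⟨b, hb⟩ := hE
  choose A B hA hA₀ hB using fun c => hb.exists_shift (branch_strictMono c)
  -- `A c ∘ B d` is the limit of the operators obtained by applying `A c` to the partial sums
  have hAB : ∀ c d x, Tendsto
      (fun N => ∑ n ∈ Finset.range N, b.coord n x • A c (b (branch d n))) atTop
      (𝓝 (A c (B d x))) := by
    intro c d x
    have := ((A c).continuous.tendsto _).comp (hB d x)
    simpa [Function.comp_def] using this
  refine ⟨A, B, fun c => ?_, fun c d hcd => ?_⟩
  · ext x
    refine tendsto_nhds_unique (b := x) (hAB c c x) ?_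
    simpa only [hA] using (b.expansion x).tendsto_sum_nat
  · obtain ⟨K, hK⟩ := exists_forall_branch_ne hcd
    let W := Submodule.span ℂ ((fun n => A c (b (branch d n))) '' (Finset.range K : Set ℕ))
    have : FiniteDimensional ℂ W :=
      FiniteDimensional.span_of_finite ℂ ((Finset.range K).finite_toSet.image _)
    refine Submodule.finiteDimensional_of_le (S₂ := W) ?_
    rintro _ ⟨x, rfl⟩
    have hx : A c (B d x) = ∑ n ∈ Finset.range K, b.coord n x • A c (b (branch d n)) := by
      refine tendsto_nhds_unique (hAB c d x) (tendsto_const_nhds.congr' ?_)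
      filter_upwards [eventually_ge_atTop K] with N hN
      refine Finset.sum_subset (Finset.range_mono hN) fun n _ hn => ?_
      rw [hA₀ c _ fun m => hK m n (by simpa using hn), smul_zero]
    change A c (B d x) ∈ W
    rw [hx]
    exact Submodule.sum_mem _ fun n hn =>
      Submodule.smul_mem _ _ (Submodule.subset_span ⟨n, hn, rfl⟩)

/-! ### Averaging in `L^p` of a product -/

section FiberMean

variable {α β : Type*} [MeasurableSpace α] [MeasurableSpace β]
  {μ : Measure α} {ν : Measure β} [IsProbabilityMeasure ν] {p : ℝ≥0∞}

/-- Jensen's inequality in the fibers of a product, for the function `‖·‖ ^ p`. -/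
theorem eLpNorm_integral_prod_le (hp : 1 ≤ p) (hp' : p ≠ ∞) {F : α × β → ℂ}
    (hF : AEStronglyMeasurable F (μ.prod ν)) :
    eLpNorm (fun x => ∫ y, F (x, y) ∂ν) p μ ≤ eLpNorm F p (μ.prod ν) := by
  have hp0 : p ≠ 0 := (zero_lt_one.trans_le hp).ne'
  have hpr : 0 < p.toReal := ENNReal.toReal_pos hp0 hp'
  rw [eLpNorm_eq_lintegral_rpow_enorm_toReal hp0 hp', eLpNorm_eq_lintegral_rpow_enorm_toReal hp0 hp',
    lintegral_prod _ (hF.enorm.pow_const _)]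
  refine ENNReal.rpow_le_rpow (lintegral_mono_ae ?_) (by positivity)
  filter_upwards [hF.prodMk_left] with x hx
  calc ‖∫ y, F (x, y) ∂ν‖ₑ ^ p.toReal
      ≤ eLpNorm (fun y => F (x, y)) 1 ν ^ p.toReal := by
        refine ENNReal.rpow_le_rpow ?_ hpr.le
        rw [eLpNorm_one_eq_lintegral_enorm]
        exact enorm_integral_le_lintegral_enorm _
    _ ≤ eLpNorm (fun y => F (x, y)) p ν ^ p.toReal :=
        ENNReal.rpow_le_rpow (eLpNorm_le_eLpNorm_of_exponent_le hp hx) hpr.le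
    _ = ∫⁻ y, ‖F (x, y)‖ₑ ^ p.toReal ∂ν := by
        rw [eLpNorm_eq_lintegral_rpow_enorm_toReal hp0 hp', ← ENNReal.rpow_mul,
          one_div_mul_cancel hpr.ne', ENNReal.rpow_one]

theorem MeasureTheory.MemLp.integral_prod [SFinite μ] (hp : 1 ≤ p) (hp' : p ≠ ∞) {F : α × β → ℂ}
    (hF : MemLp F p (μ.prod ν)) : MemLp (fun x => ∫ y, F (x, y) ∂ν) p μ :=
  ⟨hF.1.integral_prod_right', (eLpNorm_integral_prod_le hp hp' hF.1).trans_lt hF.2⟩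

/-- Averaging over the second variable is a bounded operator from `L^p (μ.prod ν)` to `L^p μ`. -/
theorem exists_fiberMean (μ : Measure α) (ν : Measure β) [IsFiniteMeasure μ]
    [IsProbabilityMeasure ν] [Fact (1 ≤ p)] (hp' : p ≠ ∞) :
    ∃ M : Lp ℂ p (μ.prod ν) →L[ℂ] Lp ℂ p μ, ∀ F, M F =ᵐ[μ] fun x => ∫ y, F (x, y) ∂ν := by
  have hp : 1 ≤ p := Fact.out
  have hmem : ∀ F : Lp ℂ p (μ.prod ν), MemLp (fun x => ∫ y, F (x, y) ∂ν) p μ :=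
    fun F => (Lp.memLp F).integral_prod hp hp'
  have hint : ∀ F : Lp ℂ p (μ.prod ν), ∀ᵐ x ∂μ, Integrable (fun y => F (x, y)) ν :=
    fun F => ((Lp.memLp F).integrable hp).prod_right_ae
  let M : Lp ℂ p (μ.prod ν) →ₗ[ℂ] Lp ℂ p μ :=
    { toFun := fun F => (hmem F).toLp _
      map_add' := by
        intro F G
        rw [← MemLp.toLp_add]
        refine MemLp.toLp_congr _ _ ?_
        filter_upwards [Measure.ae_ae_of_ae_prod (Lp.coeFn_add F G), hint F, hint G] with x hx hF hG
        rw [integral_congr_ae hx]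
        exact integral_add hF hG
      map_smul' := by
        intro a F
        rw [RingHom.id_apply, ← MemLp.toLp_const_smul]
        refine MemLp.toLp_congr _ _ ?_
        filter_upwards [Measure.ae_ae_of_ae_prod (Lp.coeFn_smul a F)] with x hx
        rw [integral_congr_ae hx]
        exact integral_smul a _ }
  refine ⟨M.mkContinuous 1 fun F => ?_, fun F => (hmem F).coeFn_toLp⟩
  rw [one_mul]
  change ‖(hmem F).toLp _‖ ≤ _
  rw [Lp.norm_toLp, Lp.norm_def]
  exact ENNReal.toReal_mono (Lp.memLp F).2.ne
    (eLpNorm_integral_prod_le hp hp' (Lp.memLp F).1)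

end FiberMean

/-- The functions in `L^p` that factor through a fixed map to a finite set span a
finite-dimensional space. -/
theorem mem_span_indicator_of_ae_eq_comp {α ι : Type*} [MeasurableSpace α] {μ : Measure α}
    [IsFiniteMeasure μ] {p : ℝ≥0∞} [Finite ι] [MeasurableSpace ι] [MeasurableSingletonClass ι]
    {π : α → ι} (hπ : Measurable π) {g : Lp ℂ p μ} {h : ι → ℂ} (hg : g =ᵐ[μ] fun x => h (π x)) :
    g ∈ Submodule.span ℂ (Set.range fun i =>
      indicatorConstLp p (hπ (measurableSet_singleton i)) (measure_ne_top μ _) (1 : ℂ)) := by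
  have := Fintype.ofFinite ι
  classical
  have hsum : g = ∑ i, h i • indicatorConstLp p (hπ (measurableSet_singleton i))
      (measure_ne_top μ _) (1 : ℂ) := by
    refine Lp.ext (hg.trans ?_)
    refine EventuallyEq.symm ((Lp.coeFn_finsetSum _ _).trans ?_)
    have h1 : ∀ᵐ x ∂μ, ∀ i, (h i • indicatorConstLp p (hπ (measurableSet_singleton i))
        (measure_ne_top μ _) (1 : ℂ) : Lp ℂ p μ) x = if π x = i then h i else 0 := by
      rw [ae_all_iff]
      intro i
      filter_upwards [Lp.coeFn_smul (h i) (indicatorConstLp p (hπ (measurableSet_singleton i))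
        (measure_ne_top μ _) (1 : ℂ)), indicatorConstLp_coeFn (p := p)
          (hs := hπ (measurableSet_singleton i)) (hμs := measure_ne_top μ _) (c := (1 : ℂ))]
        with x hx hx'
      rw [hx, Pi.smul_apply, hx']
      by_cases hxi : π x = i <;> simp [Set.indicator, hxi]
    filter_upwards [h1] with x hx
    simp [hx]
  rw [hsum]
  exact Submodule.sum_mem _ fun i _ => Submodule.smul_mem _ _ (Submodule.subset_span ⟨i, rfl⟩)

/-! ### Coin tosses -/

/-- The law of a fair coin. -/
noncomputable def fairCoin : Measure (Fin 2) :=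
  (2⁻¹ : ℝ≥0∞) • (Measure.dirac 0 + Measure.dirac 1)

instance : IsProbabilityMeasure fairCoin :=
  ⟨by simp [fairCoin, ENNReal.inv_two_add_inv_two]⟩

/-- The law of a sequence of independent tosses of a fair coin. -/
noncomputable def coinTosses : Measure (ℕ → Fin 2) := Measure.infinitePi fun _ => fairCoin

instance : IsProbabilityMeasure coinTosses := by unfold coinTosses; infer_instance

theorem coinTosses_pi (s : Finset ℕ) (t : ℕ → Set (Fin 2)) :
    coinTosses (Set.pi s t) = ∏ i ∈ s, fairCoin (t i) :=
  Measure.infinitePi_pi _ fun _ _ => .of_discrete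

theorem measurableSet_pi_fin_two (s : Finset ℕ) (t : ℕ → Set (Fin 2)) :
    MeasurableSet (Set.pi (s : Set ℕ) t) :=
  .pi s.countable_toSet fun _ _ => .of_discrete

theorem measurePreserving_coinTosses_of_pi {α : Type*} [MeasurableSpace α] {μ : Measure α}
    {e : α → ℕ → Fin 2} (he : Measurable e)
    (h : ∀ (s : Finset ℕ) (t : ℕ → Set (Fin 2)),
      μ (e ⁻¹' Set.pi s t) = ∏ i ∈ s, fairCoin (t i)) :
    MeasurePreserving e μ coinTosses := by
  refine ⟨he, Measure.eq_infinitePi _ fun s t _ => ?_⟩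
  rw [Measure.map_apply he (measurableSet_pi_fin_two s t), h]

theorem measurePreserving_coinTosses_comp {σ : ℕ → ℕ} (hσ : Function.Injective σ) :
    MeasurePreserving (fun (z : ℕ → Fin 2) k => z (σ k)) coinTosses coinTosses := by
  refine measurePreserving_coinTosses_of_pi (by fun_prop) fun s t => ?_
  have : (fun (z : ℕ → Fin 2) k => z (σ k)) ⁻¹' Set.pi s t =
      Set.pi (s.map ⟨σ, hσ⟩ : Finset ℕ) fun n => t (Function.invFun σ n) := by
    ext z
    simp [Set.mem_pi, Function.leftInverse_invFun hσ _]
  rw [this, coinTosses_pi, Finset.prod_map]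
  simp [Function.leftInverse_invFun hσ _]

open scoped Classical in
/-- The sequence that carries `x` along the positions `σ 0, σ 1, …` and agrees with `y` at the
other positions. -/
noncomputable def interleave (σ : ℕ → ℕ) (z : (ℕ → Fin 2) × (ℕ → Fin 2)) : ℕ → Fin 2 :=
  fun n => if n ∈ Set.range σ then z.1 (Function.invFun σ n) else z.2 n

theorem interleave_apply_self {σ : ℕ → ℕ} (hσ : Function.Injective σ)
    (z : (ℕ → Fin 2) × (ℕ → Fin 2)) (k : ℕ) : interleave σ z (σ k) = z.1 k := by
  simp [interleave, Function.leftInverse_invFun hσ k]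

theorem interleave_apply_of_notMem {σ : ℕ → ℕ} {n : ℕ} (hn : n ∉ Set.range σ)
    (z : (ℕ → Fin 2) × (ℕ → Fin 2)) : interleave σ z n = z.2 n := if_neg hn

theorem measurePreserving_interleave {σ : ℕ → ℕ} (hσ : Function.Injective σ) :
    MeasurePreserving (interleave σ) (coinTosses.prod coinTosses) coinTosses := by
  classical
  refine measurePreserving_coinTosses_of_pi ?_ fun s t => ?_
  · refine measurable_pi_lambda _ fun n => ?_
    by_cases hn : n ∈ Set.range σ
    · simp only [interleave, hn, if_true]; fun_prop
    · simp only [interleave, hn, if_false]; fun_prop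
  · have : interleave σ ⁻¹' Set.pi s t =
        Set.pi (s.preimage σ hσ.injOn : Finset ℕ) (fun k => t (σ k)) ×ˢ
          Set.pi (s.filter (· ∉ Set.range σ) : Finset ℕ) t := by
      ext z
      simp only [Set.mem_preimage, Set.mem_pi, Set.mem_prod, Finset.mem_coe, Finset.mem_preimage,
        Finset.mem_filter]
      constructor
      · intro h
        refine ⟨fun k hk => ?_, fun n hn => ?_⟩
        · rw [← interleave_apply_self hσ z k]
          exact h _ hk
        · rw [← interleave_apply_of_notMem hn.2 z]
          exact h _ hn.1
      · rintro ⟨h1, h2⟩ n hn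
        by_cases hnσ : n ∈ Set.range σ
        · obtain ⟨k, rfl⟩ := hnσ
          rw [interleave_apply_self hσ]
          exact h1 k hn
        · rw [interleave_apply_of_notMem hnσ]
          exact h2 n ⟨hn, hnσ⟩
    rw [this, Measure.prod_prod, coinTosses_pi, coinTosses_pi,
      ← Finset.prod_filter_mul_prod_filter_not s (· ∈ Set.range σ)]
    congr 1
    exact Finset.prod_preimage' σ s hσ.injOn fun n => fairCoin (t n)

/-- On `L^p` of the Cantor group, `B c` is the composition with the restriction of a sequence to
the positions `branch c`, and its left inverse `A c` averages over the remaining positions. The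
product `A c ∘ B d` produces functions of the coordinates common to the two branches. -/
theorem hasAlmostOrthogonalFactorizations_Lp_coinTosses {p : ℝ≥0∞} [Fact (1 ≤ p)] (hp : p ≠ ∞) :
    HasAlmostOrthogonalFactorizations (Lp ℂ p coinTosses) := by
  obtain ⟨M, hM⟩ := exists_fiberMean coinTosses coinTosses hp
  have hinj := fun c => (branch_strictMono c).injective
  let B : (ℕ → Bool) → (Lp ℂ p coinTosses →L[ℂ] Lp ℂ p coinTosses) := fun c =>
    (Lp.compMeasurePreservingₗᵢ ℂ _
      (measurePreserving_coinTosses_comp (hinj c))).toContinuousLinearMap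
  let A : (ℕ → Bool) → (Lp ℂ p coinTosses →L[ℂ] Lp ℂ p coinTosses) := fun c =>
    M ∘L (Lp.compMeasurePreservingₗᵢ ℂ _
      (measurePreserving_interleave (hinj c))).toContinuousLinearMap
  have hAB : ∀ c d f, A c (B d f) =ᵐ[coinTosses] fun x =>
      ∫ y, f (fun k => interleave (branch c) (x, y) (branch d k)) ∂coinTosses := by
    intro c d f
    refine (hM _).trans ?_
    have h1 : ⇑(Lp.compMeasurePreservingₗᵢ ℂ _ (measurePreserving_interleave (hinj c)) (B d f))
        =ᵐ[coinTosses.prod coinTosses]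
        fun z => f (fun k => interleave (branch c) z (branch d k)) :=
      (Lp.coeFn_compMeasurePreserving _ _).trans
        ((measurePreserving_interleave (hinj c)).quasiMeasurePreserving.ae_eq_comp
          (Lp.coeFn_compMeasurePreserving f (measurePreserving_coinTosses_comp (hinj d))))
    filter_upwards [Measure.ae_ae_of_ae_prod h1] with x hx
    exact integral_congr_ae hx
  refine ⟨A, B, fun c => ?_, fun c d hcd => ?_⟩
  · ext1 f
    refine Lp.ext ((hAB c c f).trans (Eventually.of_forall fun x => ?_))
    simp [interleave_apply_self (hinj c)]
  · obtain ⟨K, hK⟩ := exists_forall_branch_ne hcd.symm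
    let π : (ℕ → Fin 2) → (Fin K → Fin 2) := fun x i => x i
    let s : (Fin K → Fin 2) → (ℕ → Fin 2) := fun u n => if h : n < K then u ⟨n, h⟩ else 0
    have hπ : Measurable π := by fun_prop
    -- beyond `K`, no position of the branch `c` lies on the branch `d`
    have hdep : ∀ x y, (fun k => interleave (branch c) (x, y) (branch d k)) =
        fun k => interleave (branch c) (s (π x), y) (branch d k) := by
      intro x y
      ext1 k
      by_cases hk : branch d k ∈ Set.range (branch c)
      · obtain ⟨m, hm⟩ := hk
        have hmK : m < K := by
          by_contra h
          exact hK k m (not_lt.1 h) hm.symm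
        rw [← hm, interleave_apply_self (hinj c), interleave_apply_self (hinj c)]
        simp [s, π, hmK]
      · rw [interleave_apply_of_notMem hk, interleave_apply_of_notMem hk]
    have : FiniteDimensional ℂ (Submodule.span ℂ (Set.range fun i : Fin K → Fin 2 =>
        indicatorConstLp p (hπ (measurableSet_singleton i))
          (measure_ne_top coinTosses _) (1 : ℂ))) :=
      FiniteDimensional.span_of_finite ℂ (Set.finite_range _)
    refine Submodule.finiteDimensional_of_le (S₂ := Submodule.span ℂ
      (Set.range fun i : Fin K → Fin 2 => indicatorConstLp p (hπ (measurableSet_singleton i))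
        (measure_ne_top coinTosses _) (1 : ℂ))) ?_
    rintro _ ⟨f, rfl⟩
    refine mem_span_indicator_of_ae_eq_comp hπ (h := fun u =>
      ∫ y, f (fun k => interleave (branch c) (s u, y) (branch d k)) ∂coinTosses)
      ((hAB c d f).trans (Eventually.of_forall fun x => ?_))
    simp only [hdep x]

/-! ### Binary digits of a random number -/

theorem measurable_digits_two : Measurable fun u : ℝ => Real.digits u 2 := by
  refine measurable_pi_lambda _ fun i => ?_
  have h1 : Measurable (Fin.ofNat 2) := measurable_from_nat
  exact h1.comp (Nat.measurable_floor.comp (measurable_id.mul_const _))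

theorem digits_two_succ (u : ℝ) (i : ℕ) :
    Real.digits u 2 (i + 1) = Real.digits (2 * u) 2 i := by
  simp only [Real.digits]
  congr 2
  ring

theorem digits_two_add_one {u : ℝ} (hu : 0 ≤ u) (i : ℕ) :
    Real.digits (u + 1) 2 i = Real.digits u 2 i := by
  simp only [Real.digits]
  have h1 : (u + 1) * ((2 : ℕ) : ℝ) ^ (i + 1) = u * ((2 : ℕ) : ℝ) ^ (i + 1) + (2 ^ (i + 1) : ℕ) := by
    push_cast; ring
  rw [h1, Nat.floor_add_natCast (by positivity)]
  ext
  simp [Fin.ofNat, pow_succ]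

theorem digits_two_zero_of_lt {u : ℝ} (h1 : u < 1 / 2) : Real.digits u 2 0 = 0 := by
  have : ⌊u * ((2 : ℕ) : ℝ) ^ (0 + 1)⌋₊ = 0 := by
    rw [Nat.floor_eq_zero]; push_cast; linarith
  simp only [Real.digits, this]
  rfl

theorem digits_two_zero_of_le {u : ℝ} (h0 : 1 / 2 ≤ u) (h1 : u < 1) : Real.digits u 2 0 = 1 := by
  have : ⌊u * ((2 : ℕ) : ℝ) ^ (0 + 1)⌋₊ = 1 := by
    rw [Nat.floor_eq_iff (by positivity)]; push_cast; constructor <;> linarith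
  simp only [Real.digits, this]
  rfl

theorem fairCoin_apply (t : Set (Fin 2)) :
    fairCoin t = 2⁻¹ * t.indicator 1 0 + 2⁻¹ * t.indicator 1 1 := by
  simp [fairCoin]

/-- The binary digits of a uniform random number in `[0, 1)` are independent fair coin tosses.
The doubling map `u ↦ 2 * u mod 1` shifts the digits, so that both halves of the set on the left
are rescaled copies of the corresponding set for the shifted constraints. -/
theorem volume_digits_two (n : ℕ) (t : ℕ → Set (Fin 2)) :
    volume {u : ℝ | u ∈ Set.Ico (0 : ℝ) 1 ∧ ∀ i < n, Real.digits u 2 i ∈ t i} =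
      ∏ i ∈ Finset.range n, fairCoin (t i) := by
  induction n generalizing t with
  | zero =>
    have : {u : ℝ | 0 ≤ u ∧ u < 1} = Set.Ico 0 1 := rfl
    simp [this]
  | succ n ih =>
    set S := {u : ℝ | u ∈ Set.Ico (0 : ℝ) 1 ∧ ∀ i < n + 1, Real.digits u 2 i ∈ t i} with hS
    set S' := {u : ℝ | u ∈ Set.Ico (0 : ℝ) 1 ∧ ∀ i < n, Real.digits u 2 i ∈ t (i + 1)} with hS'
    have hvol : volume ((fun u : ℝ => 2 * u) ⁻¹' S') = 2⁻¹ * volume S' := by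
      rw [Real.volume_preimage_mul_left two_ne_zero]
      congr 1
      rw [abs_of_pos (by norm_num), ENNReal.ofReal_inv_of_pos two_pos, ENNReal.ofReal_ofNat]
    have hvol' : volume ((fun u : ℝ => 2 * u + -1) ⁻¹' S') = 2⁻¹ * volume S' := by
      rw [show (fun u : ℝ => 2 * u + -1) = (fun v => v + -1) ∘ fun u => 2 * u from rfl,
        Set.preimage_comp, Real.volume_preimage_mul_left two_ne_zero, measure_preimage_add_right]
      congr 1
      rw [abs_of_pos (by norm_num), ENNReal.ofReal_inv_of_pos two_pos, ENNReal.ofReal_ofNat]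
    have hlow : volume (S ∩ Set.Iio (1 / 2)) = 2⁻¹ * (t 0).indicator 1 0 * volume S' := by
      by_cases h0 : (0 : Fin 2) ∈ t 0
      · rw [Set.indicator_of_mem h0, Pi.one_apply, mul_one, ← hvol]
        congr 1
        ext u
        simp only [hS, hS', Set.mem_inter_iff, Set.mem_ofPred_eq, Set.mem_Ico, Set.mem_Iio,
          Set.mem_preimage, ← digits_two_succ]
        constructor
        · rintro ⟨⟨⟨hu0, -⟩, hu⟩, hu2⟩
          exact ⟨⟨by linarith, by linarith⟩, fun i hi => hu _ (by omega)⟩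
        · rintro ⟨⟨hu0, hu1⟩, hu⟩
          refine ⟨⟨⟨by linarith, by linarith⟩, fun i hi => ?_⟩, by linarith⟩
          cases i with
          | zero => rwa [digits_two_zero_of_lt (by linarith)]
          | succ i => exact hu i (by omega)
      · rw [Set.indicator_of_notMem h0, mul_zero, zero_mul]
        convert measure_empty (μ := (volume : Measure ℝ))
        refine Set.eq_empty_of_forall_notMem ?_
        rintro u ⟨⟨-, hu⟩, hu2⟩
        have := hu 0 (by omega)
        rw [digits_two_zero_of_lt hu2] at this
        exact h0 this
    have hhigh : volume (S \ Set.Iio (1 / 2)) = 2⁻¹ * (t 0).indicator 1 1 * volume S' := by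
      by_cases h0 : (1 : Fin 2) ∈ t 0
      · rw [Set.indicator_of_mem h0, Pi.one_apply, mul_one, ← hvol']
        congr 1
        ext u
        have hshift : 1 / 2 ≤ u → ∀ i, Real.digits (2 * u + -1) 2 i = Real.digits u 2 (i + 1) := by
          intro hu i
          rw [digits_two_succ, ← digits_two_add_one (by linarith)]
          congr 1
          ring
        simp only [hS, hS', Set.mem_sdiff, Set.mem_ofPred_eq, Set.mem_Ico, Set.mem_Iio,
          Set.mem_preimage, not_lt]
        constructor
        · rintro ⟨⟨⟨-, hu1⟩, hu⟩, hu2⟩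
          refine ⟨⟨by linarith, by linarith⟩, fun i hi => ?_⟩
          rw [hshift hu2]
          exact hu _ (by omega)
        · rintro ⟨⟨hu0, hu1⟩, hu⟩
          have hu2 : 1 / 2 ≤ u := by linarith
          refine ⟨⟨⟨by linarith, by linarith⟩, fun i hi => ?_⟩, hu2⟩
          cases i with
          | zero => rwa [digits_two_zero_of_le hu2 (by linarith)]
          | succ i =>
            rw [← hshift hu2]
            exact hu i (by omega)
      · rw [Set.indicator_of_notMem h0, mul_zero, zero_mul]
        convert measure_empty (μ := (volume : Measure ℝ))
        refine Set.eq_empty_of_forall_notMem ?_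
        rintro u ⟨⟨⟨-, hu1⟩, hu⟩, hu2⟩
        have := hu 0 (by omega)
        rw [digits_two_zero_of_le (not_lt.1 hu2) hu1] at this
        exact h0 this
    rw [← measure_inter_add_sdiff S measurableSet_Iio, hlow, hhigh, ← add_mul, ← fairCoin_apply,
      hS', ih fun i => t (i + 1), Finset.prod_range_succ', mul_comm]

theorem measurePreserving_digits_two :
    MeasurePreserving (fun u : ℝ => Real.digits u 2)
      ((volume : Measure ℝ).restrict (Set.Icc 0 1)) coinTosses := by
  classical
  refine measurePreserving_coinTosses_of_pi measurable_digits_two fun s t => ?_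
  obtain ⟨n, hn⟩ := s.exists_nat_subset_range
  have hset : (fun u : ℝ => Real.digits u 2) ⁻¹' Set.pi s t ∩ Set.Ico 0 1 =
      {u : ℝ | u ∈ Set.Ico (0 : ℝ) 1 ∧
        ∀ i < n, Real.digits u 2 i ∈ if i ∈ s then t i else Set.univ} := by
    ext u
    simp only [Set.mem_inter_iff, Set.mem_preimage, Set.mem_pi, Finset.mem_coe, Set.mem_ofPred_eq]
    refine ⟨fun h => ⟨h.2, fun i _ => ?_⟩, fun h => ⟨fun i hi => ?_, h.1⟩⟩
    · split_ifs with hi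
      · exact h.1 i hi
      · exact Set.mem_univ _
    · simpa [hi] using h.2 i (Finset.mem_range.1 (hn hi))
  rw [Measure.restrict_congr_set Ico_ae_eq_Icc.symm,
    Measure.restrict_apply (measurable_digits_two (measurableSet_pi_fin_two s t)), hset,
    volume_digits_two, ← Finset.prod_subset hn]
  · exact Finset.prod_congr rfl fun i hi => by simp [hi]
  · intro i _ hi
    simp [hi]

/-- The binary expansion identifies `L^p[0, 1]` with `L^p` of the Cantor group. -/
theorem nonempty_Lp_coinTosses_equiv (p : ℝ≥0∞) [Fact (1 ≤ p)] :
    Nonempty (Lp ℂ p coinTosses ≃ₗᵢ[ℂ]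
      Lp ℂ p ((volume : Measure ℝ).restrict (Set.Icc 0 1))) := by
  set lam := (volume : Measure ℝ).restrict (Set.Icc 0 1) with hlam
  have hD : MeasurePreserving (fun u : ℝ => Real.digits u 2) lam coinTosses :=
    measurePreserving_digits_two
  have hid : ∀ᵐ u ∂lam, Real.ofDigits (Real.digits u 2) = u := by
    rw [hlam, Measure.restrict_congr_set Ico_ae_eq_Icc.symm]
    exact (ae_restrict_mem measurableSet_Ico).mono fun u hu => Real.ofDigits_digits one_lt_two hu
  have hmeas : Measurable (Real.ofDigits : (ℕ → Fin 2) → ℝ) := Real.continuous_ofDigits.measurable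
  have hα : MeasurePreserving (Real.ofDigits : (ℕ → Fin 2) → ℝ) coinTosses lam := by
    refine ⟨hmeas, ?_⟩
    rw [← hD.map_eq, Measure.map_map hmeas measurable_digits_two]
    exact (Measure.map_congr hid).trans Measure.map_id
  refine ⟨LinearIsometryEquiv.ofSurjective (Lp.compMeasurePreservingₗᵢ ℂ _ hD) fun f => ?_⟩
  refine ⟨Lp.compMeasurePreserving _ hα f, Lp.ext ?_⟩
  refine (Lp.coeFn_compMeasurePreserving _ hD).trans
    ((hD.quasiMeasurePreserving.ae_eq_comp (Lp.coeFn_compMeasurePreserving f hα)).trans ?_)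
  filter_upwards [hid] with u hu
  exact congrArg f hu

theorem IsLpUnitInterval.hasAlmostOrthogonalFactorizations {E : Type*}
    [NormedAddCommGroup E] [NormedSpace ℂ E] (hE : IsLpUnitInterval E) :
    HasAlmostOrthogonalFactorizations E := by
  obtain ⟨p, hp1, -, hp, ⟨e⟩⟩ := hE
  obtain ⟨e'⟩ := nonempty_Lp_coinTosses_equiv p
  exact (hasAlmostOrthogonalFactorizations_Lp_coinTosses hp.ne).of_equiv
    (e'.trans e.symm).toContinuousLinearEquiv

/-! ### The rigidity theorem -/

theorem theorem1p1 {X Y : Type*}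
    [NormedAddCommGroup X] [NormedSpace ℂ X] [CompleteSpace X] [Nontrivial X]
    [NormedAddCommGroup Y] [NormedSpace ℂ Y] [CompleteSpace Y] [Nontrivial Y]
    [TopologicalSpace.SeparableSpace Y] (hY : IsReflexiveSpace Y)
    (hX : IsLpUnitInterval X ∨ (IsReflexiveSpace X ∧ HasSubsymmetricBasis X))
    (φ : (X →L[ℂ] X) →ₙₐ[ℂ] (Y →L[ℂ] Y))
    (hcont : Continuous φ) (hinj : Function.Injective φ)
    (hdense : ∃ T : X →L[ℂ] X, DenseRange (φ T))
    (hrank : ∀ P : X →L[ℂ] X, IsRankOneIdempotent P → IsRankOneIdempotent (φ P)) :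
    IsHomeomorph φ ∧
      ∃ S : X ≃L[ℂ] Y, ∀ A : X →L[ℂ] X,
        φ A = (S : X →L[ℂ] Y) ∘L A ∘L (S.symm : Y →L[ℂ] X) := by
  have hfact : HasAlmostOrthogonalFactorizations X :=
    hX.elim (·.hasAlmostOrthogonalFactorizations) (·.2.hasAlmostOrthogonalFactorizations)
  obtain ⟨S, hS⟩ := hfact.exists_eq_conj hY φ hcont hdense hrank
  exact ⟨isHomeomorph_of_eq_conj S hS, S, hS⟩
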